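/- For a finite multiset $\xi$ of real numbers let $|\xi|$, $\mathcal S(\xi)$ and $\mathcal M(\xi)$ denote its size, sum and median (the central element if $|\xi|$ is odd, the mean of the two central elements if $|\xi|$ is even). Given an initial multiset $\xi=\xi_{n_0}$ with $n_0=|\xi|$, the mean-median map produces for every $n\ge n_0$ the number $x_{n+1}=(n+1)\mathcal M(\xi_n)-\mathcal S(\xi_n)$ and the multiset $\xi_{n+1}=\xi_n\uplus[x_{n+1}]$. The transit time $\tau(\xi)\in\mathbb N\cup\{\infty\}$ is the least $n>n_0$ such that $x_m=x_n$ for all $m\ge n$ ($\infty$ if there is none). For $n\ge 3$ odd, a list $u_0<\dots<u_r$ is ready in $\xi_n$ if its entries are consecutive in the sorted list of the elements of $\xi_n$, starting at its central position (so that $u_0=\mathcal M(\xi_n)$), and its first differences are non-decreasing. It reproduces at time $n$, generating the list $[x_{n+2},\dots,x_{n+2r+1}]$, if moreover $x_{n+1},x_{n+2}\ge u_r$. For integers $k\ge 0$, $N\ge 2$, say that the orbit of $\xi$ consists of $N$ recursive reproductions $A_0\mapsto A_1\mapsto\dots\mapsto A_N$ with $k$ equally spaced obstacles per gap if there are times $n_0=|\xi|<n_1<\dots<n_{N-1}$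 such that: * each $A_i$ ($0\le i\le N$) is an arithmetic progression with positive modulus, and, for $0\le i<N$, $A_i$ is ready in $\xi_{n_i}$ and reproduces at time $n_i$, generating $A_{i+1}$; moreover $n_{i+1}\ge n_i+2|A_i|-1$ for $0\le i\le N-2$, i.e. all elements of $A_{i+1}$ have been generated by time $n_{i+1}$; * for $0\le i\le N-2$ one has $\max A_i<\min A_{i+1}$, and the elements of $\xi_{n_{i+1}}$ in the open interval $(\max A_i,\min A_{i+1})$ are exactly the $k$ points dividing this interval into $k+1$ equal parts, each with multiplicity one; these are also exactly the elements of the initial multiset $\xi$ in this interval; * the sequence $(x_n)$ is eventually equal to $\max A_{N-1}$. **Theorem.** (i) For every integer $k\ge 0$ there is a sequence $(\xi^{(j)})_{j\ge 0}$ of finite multisets of real numbers of strictly increasing size, with finite transit times, such that for each $j$ there is an $N\ge2$ for which the orbit of $\xi^{(j)}$ consists of $N$ recursive reproductions, starting from a pair ($|A_0|=2$, so that all $A_i$ are pairs), with $k$ equally spaced obstacles per gap, and $$\tau(\xi^{(j)})\sim\sqrt{\frac{3k+5}{k+1}}\;|\xi^{(j)}|\qquad(j\to\infty).$$ (ii)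 There is a sequence $(\xi^{(j)})_{j\ge 0}$ of finite multisets of real numbers of strictly increasing size, with finite transit times, such that for each $j$ there is an $N\ge2$ for which the orbit of $\xi^{(j)}$ consists of $N$ recursive reproductions of arithmetic progressions, starting from a progression of length $|A_0|=3$, with empty gaps ($k=0$ obstacles per gap), and $$\tau(\xi^{(j)})\sim\frac{|\xi^{(j)}|^2}{2}\qquad(j\to\infty).$$ -/

import Mathlib

open Filter Asymptotics

noncomputable section

namespace MMM

/-- The median of a finite multiset of reals: with the elements sorted as `s₀ ≤ … ≤ sₙ₋₁`, it is
`(s_⌊(n-1)/2⌋ + s_⌊n/2⌋) / 2`, i.e. the central element if `n` is odd, and the mean of the two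
central elements if `n` is even. (It is `0` for the empty multiset.) -/
def median (ξ : Multiset ℝ) : ℝ :=
  (ξ.sort.getD ((Multiset.card ξ - 1) / 2) 0 + ξ.sort.getD (Multiset.card ξ / 2) 0) / 2

/-- The number adjoined to `ξ` by the mean-median map: the real number `x` for which the mean of
the enlarged multiset `x ::ₘ ξ` is the median of `ξ`. -/
def newNumber (ξ : Multiset ℝ) : ℝ :=
  ((Multiset.card ξ : ℝ) + 1) * median ξ - ξ.sum

/-- The mean-median map. -/
def mmm (ξ : Multiset ℝ) : Multiset ℝ := newNumber ξ ::ₘ ξ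

/-- The defining property of the mean-median map: the mean of the image of `ξ` is the median
of `ξ`. -/
theorem mean_mmm (ξ : Multiset ℝ) :
    (mmm ξ).sum / (Multiset.card (mmm ξ) : ℝ) = median ξ := by
  have h : ((Multiset.card ξ : ℝ) + 1) ≠ 0 := by positivity
  simp only [mmm, newNumber, Multiset.sum_cons, Multiset.card_cons, Nat.cast_add, Nat.cast_one]
  field_simp
  ring

/-- The multiset `ξ_n` of size `n` in the orbit of the initial multiset `ξ`, for `n ≥ |ξ|`
(so `ξ_n = ξ` for `n = |ξ|`, and `ξ_{n+1}` is the image of `ξ_n`). -/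
def stage (ξ : Multiset ℝ) (n : ℕ) : Multiset ℝ := mmm^[n - Multiset.card ξ] ξ

/-- The iterate `x_n` in the orbit of `ξ`, for `n > |ξ|`: the number adjoined to `ξ_{n-1}` to
obtain `ξ_n`. -/
def iterate (ξ : Multiset ℝ) (n : ℕ) : ℝ := newNumber (stage ξ (n - 1))

/-- The transit time `τ(ξ)`: the least time step `n > |ξ|` from which the sequence of new numbers
`x_n, x_{n+1}, …` is constant, and `∞` if there is none. -/
def transitTime (ξ : Multiset ℝ) : ℕ∞ :=
  sInf ((fun n : ℕ => (n : ℕ∞)) ''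
    {n : ℕ | Multiset.card ξ < n ∧ ∀ m ≥ n, iterate ξ m = iterate ξ n})

/-- A list `l = [u₀, …, u_k]` of reals is ready in the multiset `ξ` if `ξ` has odd size at least
`3`, the `u_i` are consecutive elements of the sorted list of elements of `ξ` beginning at its
central position (so `u₀` is the median), and the first differences of `l` are positive and
non-decreasing. -/
def IsReady (ξ : Multiset ℝ) (l : List ℝ) : Prop :=
  3 ≤ Multiset.card ξ ∧ Odd (Multiset.card ξ) ∧ l ≠ [] ∧
  l <+: ξ.sort.drop (Multiset.card ξ / 2) ∧
  (∀ i, i + 1 < l.length → l.getD i 0 < l.getD (i + 1) 0) ∧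
  (∀ i, i + 2 < l.length →
    l.getD (i + 1) 0 - l.getD i 0 ≤ l.getD (i + 2) 0 - l.getD (i + 1) 0)

/-- In the orbit of `ξ`, the list `l = [u₀, …, u_k]` reproduces at time `n`, generating `l'`:
`l` is ready in `ξ_n`, both `x_{n+1}` and `x_{n+2}` are at least `u_k`, and `l'` is the list of the
`2k` iterates `x_{n+2}, …, x_{n+2k+1}`, which are computed as the median walks across `l`. -/
def Reproduces (ξ : Multiset ℝ) (n : ℕ) (l l' : List ℝ) : Prop :=
  IsReady (stage ξ n) l ∧
  (∀ u ∈ l, u ≤ iterate ξ (n + 1) ∧ u ≤ iterate ξ (n + 2)) ∧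
  l' = (List.range (2 * (l.length - 1))).map (fun j => iterate ξ (n + 2 + j))

/-- The list is an arithmetic progression with positive modulus. -/
def IsAP (l : List ℝ) : Prop :=
  ∃ a b : ℝ, 0 < b ∧ l = (List.range l.length).map (fun j : ℕ => a + (j : ℝ) * b)

/-- The `k` equally spaced points partitioning the interval from `a` to `b` uniformly. -/
def equallySpaced (k : ℕ) (a b : ℝ) : Multiset ℝ :=
  (Multiset.range k).map (fun j : ℕ => a + ((j : ℝ) + 1) / ((k : ℝ) + 1) * (b - a))

open Classical in
/-- The elements of `ξ` (with multiplicity) strictly between `a` and `b`. -/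
def between (ξ : Multiset ℝ) (a b : ℝ) : Multiset ℝ := ξ.filter (fun x => a < x ∧ x < b)

/-- The orbit of `ξ` consists of `N` recursive reproductions `A 0 ↦ A 1 ↦ ⋯ ↦ A N` of arithmetic
progressions, at times `n 0 = |ξ| < n 1 < ⋯ < n (N - 1)`, after which it stabilises; each gap
between consecutive progressions which the median walks across contains exactly `k` equally
spaced obstacles, all of them elements of `ξ`. -/
structure IsReproductionChain (ξ : Multiset ℝ) (k N : ℕ) (n : ℕ → ℕ) (A : ℕ → List ℝ) :
    Prop where
  two_le : 2 ≤ N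
  /-- The first progression reproduces at the initial time. -/
  start : n 0 = Multiset.card ξ
  /-- A progression reproduces only after all its elements have been generated. -/
  generated : ∀ i, i + 1 < N → n i + 2 * (A i).length ≤ n (i + 1) + 1
  isAP : ∀ i ≤ N, IsAP (A i)
  reproduces : ∀ i < N, Reproduces ξ (n i) (A i) (A (i + 1))
  /-- Consecutive progressions are in increasing order. -/
  gap_pos : ∀ i, i + 1 < N → (A i).getLastD 0 < (A (i + 1)).headD 0
  /-- The obstacles in each gap are elements of the initial multiset. -/
  obstacles_initial : ∀ i, i + 1 < N →
    between ξ ((A i).getLastD 0) ((A (i + 1)).headD 0) =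
      equallySpaced k ((A i).getLastD 0) ((A (i + 1)).headD 0)
  /-- No other obstacle has appeared by the time the median has walked across the gap. -/
  obstacles : ∀ i, i + 1 < N →
    between (stage ξ (n (i + 1))) ((A i).getLastD 0) ((A (i + 1)).headD 0) =
      equallySpaced k ((A i).getLastD 0) ((A (i + 1)).headD 0)
  /-- The orbit stabilises at the largest element of the second-to-last progression. -/
  stabilises : ∃ T, ∀ m ≥ T, iterate ξ m = (A (N - 1)).getLastD 0

end MMM

end

/-! If n is odd and c is the median of ξ_n, then ξ_{n+1} has sum (n+1)c. When its central elements
are c ≤ d, this gives x_{n+2} = c + (n+2)(d-c)/2 and x_{n+3} = x_{n+2} + (d-c): each move of the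
median emits two numbers, separated by the length of that move (`IsSplit.step`). Hence m equal moves
emit 2m numbers in progression with the same modulus (`IsSplit.walk`), and once the central elements
coincide the orbit is constant.

With modulus 1 everything is explicit. The median takes e·2^i + 1 steps across A_i, emitting
A_{i+1}, then k+1 steps across a gap of length at least n₀/2 - e, emitting numbers no smaller than
(n₀+2)(n₀-2e)/(4(k+1)). While max A_M stays below this bound those numbers never interfere
(`ReadySplit.succ`). Extra copies of max A_M in the initial multiset stop the orbit there, at a
known time (`ReadySplit.isReproductionChain`).

It remains to take M almost as large as the bound allows. For e = 0, M is linear in n₀ and the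
constant is fixed by a quadratic equation; for e = 1 the progressions grow exponentially, M is
logarithmic in n₀ and the time is quadratic. -/

namespace MMM

/-! ### Sorting and medians -/

theorem sort_add {s t : Multiset ℝ} (h : ∀ x ∈ s, ∀ y ∈ t, x ≤ y) :
    (s + t).sort = s.sort ++ t.sort := by
  refine List.Perm.eq_of_pairwise' (r := (· ≤ ·)) (Multiset.pairwise_sort _ _) ?_ ?_
  · rw [List.pairwise_append]
    refine ⟨Multiset.pairwise_sort _ _, Multiset.pairwise_sort _ _, fun a ha b hb => ?_⟩
    exact h a ((Multiset.mem_sort _).1 ha) b ((Multiset.mem_sort _).1 hb)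
  · rw [← Multiset.coe_eq_coe, ← Multiset.coe_add]
    simp

theorem sort_cons {c : ℝ} {t : Multiset ℝ} (h : ∀ y ∈ t, c ≤ y) :
    (c ::ₘ t).sort = c :: t.sort :=
  Multiset.sort_cons _ _ _ h

theorem median_odd {l u : Multiset ℝ} {c : ℝ} (hl : ∀ x ∈ l, x ≤ c) (hu : ∀ x ∈ u, c ≤ x)
    (hc : Multiset.card u = Multiset.card l) : median (l + c ::ₘ u) = c := by
  have hs : (l + c ::ₘ u).sort = l.sort ++ c :: u.sort := by
    rw [sort_add, sort_cons hu]
    intro x hx y hy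
    rcases Multiset.mem_cons.1 hy with rfl | hy
    · exact hl x hx
    · exact (hl x hx).trans (hu y hy)
  have h1 : (Multiset.card (l + c ::ₘ u) - 1) / 2 = Multiset.card l := by simp; omega
  have h2 : Multiset.card (l + c ::ₘ u) / 2 = Multiset.card l := by simp; omega
  rw [median, h1, h2, hs, List.getD_append_right _ _ _ _ (by simp)]
  simp

theorem median_even {l u : Multiset ℝ} {c d : ℝ} (hl : ∀ x ∈ l, x ≤ c) (hcd : c ≤ d)
    (hu : ∀ x ∈ u, d ≤ x) (hc : Multiset.card u = Multiset.card l) :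
    median (l + c ::ₘ d ::ₘ u) = (c + d) / 2 := by
  have hcu : ∀ y ∈ d ::ₘ u, c ≤ y := by
    intro y hy
    rcases Multiset.mem_cons.1 hy with rfl | hy
    · exact hcd
    · exact hcd.trans (hu y hy)
  have hs : (l + c ::ₘ d ::ₘ u).sort = l.sort ++ c :: d :: u.sort := by
    rw [sort_add, sort_cons hcu, sort_cons hu]
    intro x hx y hy
    rcases Multiset.mem_cons.1 hy with rfl | hy
    · exact hl x hx
    · exact (hl x hx).trans (hcu y hy)
  have h1 : (Multiset.card (l + c ::ₘ d ::ₘ u) - 1) / 2 = Multiset.card l := by simp; omega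
  have h2 : Multiset.card (l + c ::ₘ d ::ₘ u) / 2 = Multiset.card l + 1 := by simp; omega
  rw [median, h1, h2, hs, List.getD_append_right _ _ _ _ (by simp),
    List.getD_append_right _ _ _ _ (by simp)]
  simp

/-! ### The orbit -/

theorem stage_card (ξ : Multiset ℝ) : stage ξ (Multiset.card ξ) = ξ := by simp [stage]

theorem stage_succ {ξ : Multiset ℝ} {n : ℕ} (h : Multiset.card ξ ≤ n) :
    stage ξ (n + 1) = iterate ξ (n + 1) ::ₘ stage ξ n := by
  rw [iterate, stage, Nat.succ_sub h, Function.iterate_succ_apply']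
  rfl

theorem card_stage {ξ : Multiset ℝ} {n : ℕ} (h : Multiset.card ξ ≤ n) :
    Multiset.card (stage ξ n) = n := by
  induction n, h using Nat.le_induction with
  | base => rw [stage_card]
  | succ n h ih => rw [stage_succ h, Multiset.card_cons, ih]

theorem sum_stage_succ {ξ : Multiset ℝ} {n : ℕ} (h : Multiset.card ξ ≤ n) :
    (stage ξ (n + 1)).sum = (n + 1) * median (stage ξ n) := by
  rw [stage_succ h, Multiset.sum_cons, iterate, Nat.add_sub_cancel, newNumber, card_stage h]
  ring

theorem le_stage {ξ : Multiset ℝ} {n : ℕ} (h : Multiset.card ξ ≤ n) : ξ ≤ stage ξ n := by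
  induction n, h using Nat.le_induction with
  | base => rw [stage_card]
  | succ n h ih => rw [stage_succ h]; exact ih.trans (Multiset.le_cons_self _ _)

/-! ### Dynamics of the median, two time units per step -/

/-- The multiset `ξ_{n+1}` (with `n` odd) is split at its lower central element `c`, which is the
median of `ξ_n`; the elements following `c` form `u`. -/
structure IsSplit (ξ : Multiset ℝ) (n : ℕ) (c : ℝ) (u : Multiset ℝ) : Prop where
  card_le : Multiset.card ξ ≤ n
  exists_lower : ∃ l : Multiset ℝ, stage ξ (n + 1) = l + c ::ₘ u ∧ 2 * Multiset.card l + 1 = n ∧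
    ∀ x ∈ l, x ≤ c
  le_upper : ∀ x ∈ u, c ≤ x
  sum_eq : (stage ξ (n + 1)).sum = (n + 1) * c

/-- The number x_{n+2} lands at or above d, so d is the median of ξ_{n+2}; comparing the sums of
ξ_{n+2} and ξ_{n+3} then yields x_{n+3}. -/
theorem IsSplit.step {ξ r : Multiset ℝ} {n : ℕ} {c d : ℝ} (h : IsSplit ξ n c (d ::ₘ r))
    (hd : ∀ x ∈ r, d ≤ x) :
    IsSplit ξ (n + 2) d
      ((c + (n + 2) * (d - c) / 2) ::ₘ (c + (n + 2) * (d - c) / 2 + (d - c)) ::ₘ r) ∧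
    iterate ξ (n + 2) = c + (n + 2) * (d - c) / 2 ∧
    iterate ξ (n + 3) = c + (n + 2) * (d - c) / 2 + (d - c) := by
  obtain ⟨hn, ⟨l, hl, hln, hlc⟩, hu, hsum⟩ := h
  have hcd : c ≤ d := hu d (Multiset.mem_cons_self _ _)
  have hcard : Multiset.card r = Multiset.card l := by
    have := card_stage (Nat.le_succ_of_le hn)
    rw [Nat.succ_eq_add_one, hl] at this
    simp at this
    omega
  have hn1 : Multiset.card ξ ≤ n + 1 := by omega
  have hn2 : Multiset.card ξ ≤ n + 2 := by omega
  have hm1 : median (stage ξ (n + 1)) = (c + d) / 2 := by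
    rw [hl]; exact median_even hlc hcd hd hcard
  have hi2 : iterate ξ (n + 2) = c + (n + 2) * (d - c) / 2 := by
    rw [iterate, show n + 2 - 1 = n + 1 from rfl, newNumber, card_stage hn1, hm1, hsum]
    push_cast; ring
  set y := c + (n + 2) * (d - c) / 2 with hy
  have hdy : d ≤ y := by
    have : 0 ≤ (n : ℝ) * (d - c) := mul_nonneg (Nat.cast_nonneg _) (by linarith)
    rw [hy]; linarith
  have hs2 : stage ξ (n + 2) = c ::ₘ l + d ::ₘ y ::ₘ r := by
    rw [stage_succ hn1, hl, hi2]
    simp only [← Multiset.singleton_add]; abel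
  have hyr : ∀ x ∈ y ::ₘ r, d ≤ x := by
    intro x hx
    rcases Multiset.mem_cons.1 hx with rfl | hx
    · exact hdy
    · exact hd x hx
  have hld : ∀ x ∈ c ::ₘ l, x ≤ d := by
    intro x hx
    rcases Multiset.mem_cons.1 hx with rfl | hx
    · exact hcd
    · exact (hlc x hx).trans hcd
  have hm2 : median (stage ξ (n + 2)) = d := by
    rw [hs2]; exact median_odd hld hyr (by simp [hcard])
  have hsum2 := sum_stage_succ hn1
  have hsum3 := sum_stage_succ hn2
  rw [hm1] at hsum2
  rw [hm2] at hsum3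
  have hi3 : iterate ξ (n + 3) = y + (d - c) := by
    rw [iterate, show n + 3 - 1 = n + 2 from rfl, newNumber, card_stage hn2, hm2, hsum2]
    push_cast; rw [hy]; ring
  refine ⟨⟨hn2, ⟨c ::ₘ l, ?_, by simp; omega, hld⟩, ?_, ?_⟩, hi2, hi3⟩
  · rw [stage_succ hn2, hs2, hi3]
    simp only [← Multiset.singleton_add]; abel
  · intro x hx
    rcases Multiset.mem_cons.1 hx with rfl | hx
    · exact hdy
    rcases Multiset.mem_cons.1 hx with rfl | hx
    · linarith
    · exact hd x hx
  · exact hsum3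

/-- The points `a, a + d, …, a + (m - 1) d` as a multiset. -/
def progression (a d : ℝ) (m : ℕ) : Multiset ℝ :=
  (Multiset.range m).map (fun j : ℕ => a + (j : ℝ) * d)

theorem progression_succ (a d : ℝ) (m : ℕ) :
    progression a d (m + 1) = a ::ₘ progression (a + d) d m := by
  have : Multiset.range (m + 1) = 0 ::ₘ (Multiset.range m).map Nat.succ := by
    rw [Multiset.range, List.range_succ_eq_map]; simp [Multiset.range]
  rw [progression, this, Multiset.map_cons, Multiset.map_map, progression]
  congr 1
  · simp
  · refine Multiset.map_congr rfl fun j _ => ?_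
    simp; ring

theorem progression_succ_top (a d : ℝ) (m : ℕ) :
    progression a d (m + 1) = (a + m * d) ::ₘ progression a d m := by
  simp [progression, Multiset.range_succ]

theorem mem_progression {a d x : ℝ} {m : ℕ} :
    x ∈ progression a d m ↔ ∃ j : ℕ, j < m ∧ a + j * d = x := by
  simp [progression]

theorem le_of_mem_progression {a d x : ℝ} {m : ℕ} (hd : 0 ≤ d) (hx : x ∈ progression a d m) :
    a ≤ x := by
  obtain ⟨j, -, rfl⟩ := mem_progression.1 hx
  have : 0 ≤ (j : ℝ) * d := by positivity
  linarith

/-- The median walks across an arithmetic progression. -/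
theorem IsSplit.walk {ξ : Multiset ℝ} {d : ℝ} (hd : 0 ≤ d) (m : ℕ) :
    ∀ {n : ℕ} {a b : ℝ} {r : Multiset ℝ}, IsSplit ξ n a (progression (a + d) d m + r) →
    (∀ x ∈ r, a + m * d ≤ x) → b = a + (n + 2) * d / 2 → a + m * d ≤ b →
    IsSplit ξ (n + 2 * m) (a + m * d) (progression b d (2 * m) + r) ∧
    (∀ j < 2 * m, iterate ξ (n + 2 + j) = b + j * d) ∧
    stage ξ (n + 2 * m + 1) = progression b d (2 * m) + stage ξ (n + 1) := by
  induction m with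
  | zero =>
    intro n a b r h hr hb hab
    refine ⟨?_, by simp, by simp [progression]⟩
    simpa [progression] using h
  | succ m ih =>
    intro n a b r h hr hb hab
    rw [progression_succ, Multiset.cons_add] at h
    have hcast : a + ((m + 1 : ℕ) : ℝ) * d = (a + d) + m * d := by push_cast; ring
    rw [hcast] at hab hr ⊢
    have hmd : 0 ≤ (m : ℝ) * d := by positivity
    have hn := h.card_le
    obtain ⟨h', hi2, hi3⟩ := h.step (by
      intro x hx
      rcases Multiset.mem_add.1 hx with hx | hx
      · have := le_of_mem_progression hd hx; linarith
      · have := hr x hx; linarith)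
    have e1 : a + (n + 2) * (a + d - a) / 2 = b := by rw [hb]; ring
    have e2 : a + (n + 2) * (a + d - a) / 2 + (a + d - a) = b + d := by rw [hb]; ring
    rw [e2] at hi3 h'
    rw [e1] at hi2 h'
    have e3 : b ::ₘ (b + d) ::ₘ (progression (a + d + d) d m + r)
        = progression (a + d + d) d m + (b ::ₘ (b + d) ::ₘ r) := by
      simp only [← Multiset.singleton_add]; abel
    rw [e3] at h'
    -- Time has grown by 2 and the median by d, so the predicted start a + (n+2)d/2 moves by 2d,
    -- just past the two numbers emitted. By `hab` these lie beyond the progression and join the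
    -- remainder.
    obtain ⟨h1, h2, h3⟩ := ih (b := b + d + d) h' (by
      intro x hx
      rcases Multiset.mem_cons.1 hx with rfl | hx
      · exact hab
      rcases Multiset.mem_cons.1 hx with rfl | hx
      · linarith
      · exact hr x hx) (by rw [hb]; push_cast; ring) (by linarith)
    have e4 : progression b d (2 * (m + 1)) = b ::ₘ (b + d) ::ₘ progression (b + d + d) d (2 * m) := by
      rw [show 2 * (m + 1) = 2 * m + 1 + 1 by ring, progression_succ, progression_succ]
    have e5 : n + 2 * (m + 1) = n + 2 + 2 * m := by ring
    rw [e4, e5]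
    refine ⟨?_, ?_, ?_⟩
    · convert h1 using 1
      simp only [← Multiset.singleton_add]; abel
    · intro j hj
      match j with
      | 0 => simpa using hi2
      | 1 => simpa using hi3
      | j + 2 =>
        have := h2 j (by omega)
        rw [show n + 2 + (j + 2) = n + 2 + 2 + j by ring, this]
        push_cast; ring
    · rw [h3, stage_succ (by omega : Multiset.card ξ ≤ n + 2),
        stage_succ (by omega : Multiset.card ξ ≤ n + 1), hi2, hi3]
      simp only [← Multiset.singleton_add]; abel

/-- If the two central elements are equal, then the orbit is stationary. -/
theorem IsSplit.stationary {ξ : Multiset ℝ} {c : ℝ} :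
    ∀ (m : ℕ) {n : ℕ} {r : Multiset ℝ}, IsSplit ξ n c (c ::ₘ r) →
    iterate ξ (n + 2 + m) = c := by
  intro m
  induction m using Nat.twoStepInduction with
  | zero =>
    intro n r h
    simpa using (h.step fun x hx => h.le_upper x (Multiset.mem_cons_of_mem hx)).2.1
  | one =>
    intro n r h
    simpa using (h.step fun x hx => h.le_upper x (Multiset.mem_cons_of_mem hx)).2.2
  | more m ih _ =>
    intro n r h
    have h' := (h.step fun x hx => h.le_upper x (Multiset.mem_cons_of_mem hx)).1
    simp only [sub_self, mul_zero, zero_div, add_zero] at h'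
    rw [← ih h']
    congr 1; ring

/-- Constancy from an earlier time would force x_{n+1} = x_{n+2} = c. -/
theorem IsSplit.transitTime_eq {ξ r : Multiset ℝ} {n : ℕ} {c : ℝ} (h : IsSplit ξ n c (c ::ₘ r))
    (hne : iterate ξ (n + 1) ≠ c) : transitTime ξ = ((n + 2 : ℕ) : ℕ∞) := by
  have hn := h.card_le
  refine IsLeast.csInf_eq ⟨⟨n + 2, ⟨by omega, fun m hm => ?_⟩, rfl⟩, ?_⟩
  · obtain ⟨q, rfl⟩ := Nat.exists_eq_add_of_le hm
    rw [h.stationary, ← h.stationary 0, Nat.add_zero]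
  · rintro _ ⟨m, ⟨-, hm⟩, rfl⟩
    by_contra hlt
    have hlt' : m < n + 2 := Nat.cast_lt.1 (not_le.1 hlt)
    refine hne ?_
    rw [hm (n + 1) (by omega), ← hm (n + 2) (by omega), ← h.stationary 0, Nat.add_zero]

/-- A progression at the centre of the multiset is ready. -/
theorem IsSplit.isReady {ξ r : Multiset ℝ} {n m : ℕ} {a d : ℝ} (hd : 0 < d)
    (h : IsSplit ξ n a (progression (a + d) d m + r)) (hn : 3 ≤ n)
    (hr : ∀ x ∈ r, a + m * d ≤ x) (hx : iterate ξ (n + 1) ∈ r) :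
    IsReady (stage ξ n) ((List.range (m + 1)).map (fun j : ℕ => a + (j : ℝ) * d)) := by
  obtain ⟨hξ, ⟨l, hl, hln, hlc⟩, hu, hsum⟩ := h
  -- The split describes ξ_{n+1}; deleting x_{n+1} from the remainder recovers ξ_n, to which
  -- readiness refers.
  obtain ⟨t, rfl⟩ := Multiset.exists_cons_of_mem hx
  have hs : stage ξ n = l + (progression a d (m + 1) + t) := by
    rw [stage_succ hξ] at hl
    refine (Multiset.cons_inj_right (iterate ξ (n + 1))).1 ?_
    rw [hl, progression_succ]
    simp only [← Multiset.singleton_add]; abel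
  have hap : (progression a d (m + 1)).sort
      = (List.range (m + 1)).map (fun j : ℕ => a + (j : ℝ) * d) := by
    refine List.Perm.eq_of_pairwise' (r := (· ≤ ·)) (Multiset.pairwise_sort _ _) ?_ ?_
    · rw [List.pairwise_map]
      refine List.pairwise_lt_range.imp fun {i j} hij => ?_
      have : (i : ℝ) ≤ j := by exact_mod_cast hij.le
      nlinarith
    · simpa [progression, Multiset.range] using List.mergeSort_perm _ _
  have hsort : (stage ξ n).sort
      = l.sort ++ ((List.range (m + 1)).map (fun j : ℕ => a + (j : ℝ) * d) ++ t.sort) := by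
    rw [hs, sort_add, sort_add, hap]
    · intro x hx y hy
      obtain ⟨j, hj, rfl⟩ := mem_progression.1 hx
      have := hr y (Multiset.mem_cons_of_mem hy)
      have : (j : ℝ) ≤ m := by exact_mod_cast Nat.le_of_lt_succ hj
      nlinarith
    · intro x hx y hy
      have h1 := hlc x hx
      rcases Multiset.mem_add.1 hy with hy | hy
      · exact h1.trans (le_of_mem_progression hd.le hy)
      · exact h1.trans (hu y (Multiset.mem_add.2 (Or.inr (Multiset.mem_cons_of_mem hy))))
  have hget : ∀ i < m + 1, ((List.range (m + 1)).map (fun j : ℕ => a + (j : ℝ) * d)).getD i 0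
      = a + i * d := by
    intro i hi
    rw [List.getD_eq_getElem _ _ (by simpa using hi)]
    simp
  refine ⟨by rwa [card_stage hξ], ?_, by simp, ?_, ?_, ?_⟩
  · rw [card_stage hξ]; exact ⟨Multiset.card l, hln.symm⟩
  · rw [card_stage hξ, hsort, List.drop_append_of_le_length (by simp; omega),
      List.drop_of_length_le (by simp; omega), List.nil_append]
    exact List.prefix_append _ _
  · intro i hi
    simp only [List.length_map, List.length_range] at hi
    rw [hget _ (by omega), hget _ hi]
    push_cast; linarith
  · intro i hi
    simp only [List.length_map, List.length_range] at hi
    rw [hget _ (by omega), hget _ (by omega), hget _ hi]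
    push_cast; linarith

end MMM

namespace MMM

/-! ### Equally spaced obstacles -/

/-- The obstacles together with the far endpoint form a progression, so crossing a gap is another
instance of `IsSplit.walk`. -/
theorem progression_eq_cons_equallySpaced (k : ℕ) (a b : ℝ) :
    progression (a + (b - a) / (k + 1)) ((b - a) / (k + 1)) (k + 1) =
      b ::ₘ equallySpaced k a b := by
  have hk : (k : ℝ) + 1 ≠ 0 := by positivity
  rw [progression_succ_top]
  congr 1
  · field_simp; ring
  · refine Multiset.map_congr rfl fun j _ => ?_
    field_simp; ring

theorem mem_equallySpaced {k : ℕ} {a b x : ℝ} (hab : a < b) (hx : x ∈ equallySpaced k a b) :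
    a < x ∧ x < b := by
  obtain ⟨j, hj, rfl⟩ := Multiset.mem_map.1 hx
  have hj' : (j : ℝ) < k := by exact_mod_cast Multiset.mem_range.1 hj
  have hk : 0 < (k : ℝ) + 1 := by positivity
  have h1 : ((j : ℝ) + 1) / (k + 1) < 1 := by rw [div_lt_one hk]; linarith
  have h0 : 0 < ((j : ℝ) + 1) / (k + 1) := by positivity
  constructor <;> nlinarith

theorem between_mono {s t : Multiset ℝ} (h : s ≤ t) (a b : ℝ) : between s a b ≤ between t a b :=
  Multiset.filter_le_filter _ h

theorem between_add_le {s t : Multiset ℝ} {a b : ℝ} (h : ∀ x ∈ s, x ≤ a ∨ b ≤ x) :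
    between (s + t) a b ≤ t := by
  have hs : between s a b = 0 := by
    refine Multiset.filter_eq_nil.2 fun x hx hab => ?_
    rcases h x hx with h | h <;> linarith [hab.1, hab.2]
  rw [between, Multiset.filter_add, ← between, hs, zero_add]
  exact Multiset.filter_le _ _

/-! ### Recursively reproducing progressions

The progressions have modulus `1`; the `i`-th one has `e * 2 ^ i + 2` elements, and the initial
multiset has `n₀` elements. -/

section Chain

variable (e k n₀ : ℕ)

/-- The number of steps in the `i`-th progression. -/
def apSteps (e i : ℕ) : ℕ := e * 2 ^ i + 1

/-- The time at which the `i`-th progression reproduces. -/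
def apTime (i : ℕ) : ℕ := n₀ + 2 * (e * (2 ^ i - 1) + (k + 2) * i)

/-- The distance between the `i`-th progression and the next one. -/
noncomputable def apGap (i : ℕ) : ℝ := n₀ / 2 - e + (k + 2) * i

/-- The least element of the `i`-th progression. -/
noncomputable def apMin (i : ℕ) : ℝ :=
  e * (2 ^ i - 1) + i * (1 + n₀ / 2 - e) + (k + 2) * (i * (i - 1)) / 2

/-- The greatest element of the `i`-th progression. -/
noncomputable def apMax (i : ℕ) : ℝ := apMin e k n₀ i + apSteps e i * 1

/-- The `i`-th progression. -/
noncomputable def apList (i : ℕ) : List ℝ :=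
  (List.range (apSteps e i + 1)).map (fun j : ℕ => apMin e k n₀ i + (j : ℝ) * 1)

/-- The obstacles between the `i`-th progression and the next one. -/
noncomputable def obstacles (i : ℕ) : Multiset ℝ := equallySpaced k (apMax e k n₀ i) (apMin e k n₀ (i + 1))

/-- The elements of the initial multiset following the `i`-th progression, if there are `M` gaps
and the greatest element of the last progression has multiplicity `s`. -/
noncomputable def following (M s i : ℕ) : Multiset ℝ :=
  ∑ l ∈ Finset.Ico i M, obstacles e k n₀ l + Multiset.replicate s (apMax e k n₀ M)

variable {e k n₀}

theorem apSteps_succ (i : ℕ) : apSteps e (i + 1) + 1 = 2 * apSteps e i := by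
  simp only [apSteps]; ring

theorem apTime_zero : apTime e k n₀ 0 = n₀ := by simp [apTime]

theorem apTime_succ (i : ℕ) :
    apTime e k n₀ (i + 1) = apTime e k n₀ i + 2 * apSteps e i + 2 * (k + 1) := by
  obtain ⟨t, ht⟩ := Nat.exists_eq_add_of_le (Nat.one_le_two_pow (n := i))
  have h2 : 2 ^ (i + 1) - 1 = 2 * t + 1 := by rw [pow_succ]; omega
  simp only [apTime, apSteps, h2, ht]
  rw [Nat.add_sub_cancel_left]
  ring

theorem cast_apTime (i : ℕ) :
    (apTime e k n₀ i : ℝ) = n₀ + 2 * (e * (2 ^ i - 1) + (k + 2) * i) := by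
  have := Nat.one_le_two_pow (n := i)
  simp only [apTime]
  push_cast [this]
  ring

theorem apMin_zero : apMin e k n₀ 0 = 0 := by simp [apMin]

theorem apMin_succ (i : ℕ) : apMin e k n₀ (i + 1) = apMax e k n₀ i + apGap e k n₀ i := by
  simp only [apMin, apMax, apGap, apSteps]; push_cast; ring

theorem apMin_succ' (i : ℕ) :
    apMin e k n₀ (i + 1) = apMin e k n₀ i + ((apTime e k n₀ i : ℝ) + 2) * 1 / 2 := by
  rw [cast_apTime]; simp only [apMin]; push_cast; ring

/-- The e·2^i in the elapsed time is cancelled by the length of the progression, so the gaps only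
widen with i. -/
theorem half_le_apGap (i : ℕ) : (n₀ : ℝ) / 2 - e ≤ apGap e k n₀ i := by
  have : 0 ≤ ((k : ℝ) + 2) * i := by positivity
  simp only [apGap]; linarith

theorem apGap_pos (he : 2 * e < n₀) (i : ℕ) : 0 < apGap e k n₀ i := by
  have h : 2 * (e : ℝ) < n₀ := by exact_mod_cast he
  linarith [half_le_apGap (e := e) (k := k) (n₀ := n₀) i]

theorem apMax_lt_apMin_succ (he : 2 * e < n₀) (i : ℕ) :
    apMax e k n₀ i < apMin e k n₀ (i + 1) := by
  linarith [apMin_succ (e := e) (k := k) (n₀ := n₀) i, apGap_pos (k := k) he i]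

theorem apMin_add_one_le_apMax (i : ℕ) : apMin e k n₀ i + 1 ≤ apMax e k n₀ i := by
  simp only [apMax, apSteps]
  push_cast
  have : 0 ≤ (e : ℝ) * 2 ^ i := by positivity
  linarith

theorem apMax_mono (he : 2 * e < n₀) : Monotone (apMax e k n₀) :=
  monotone_nat_of_le_succ fun i =>
    (apMax_lt_apMin_succ he i).le.trans (by linarith [apMin_add_one_le_apMax (e := e) (k := k) (n₀ := n₀) (i + 1)])

theorem apMax_pos (he : 2 * e < n₀) (i : ℕ) : 0 < apMax e k n₀ i := by
  have h1 := apMax_mono (k := k) he (Nat.zero_le i)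
  have h2 := apMin_add_one_le_apMax (e := e) (k := k) (n₀ := n₀) 0
  rw [apMin_zero] at h2
  linarith

theorem following_succ {M s i : ℕ} (hi : i < M) :
    following e k n₀ M s i = obstacles e k n₀ i + following e k n₀ M s (i + 1) := by
  rw [following, Finset.sum_eq_sum_Ico_succ_bot hi, add_assoc, ← following]

theorem apMax_le_of_mem_following (he : 2 * e < n₀) {M s i : ℕ} (hi : i ≤ M) {x : ℝ}
    (hx : x ∈ following e k n₀ M s i) : apMax e k n₀ i ≤ x := by
  rcases Multiset.mem_add.1 hx with hx | hx
  · obtain ⟨l, hl, hx⟩ := Multiset.mem_sum.1 hx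
    have h1 := apMax_mono (k := k) he (Finset.mem_Ico.1 hl).1
    exact h1.trans (mem_equallySpaced (apMax_lt_apMin_succ he l) hx).1.le
  · rw [Multiset.eq_of_mem_replicate hx]
    exact apMax_mono he hi

/-- The numbers generated while the median walks across a gap are beyond the last progression. -/
theorem apMax_lt_generated {M : ℕ} (he : 2 * e < n₀)
    (hM : apMax e k n₀ M < ((n₀ : ℝ) + 2) * (n₀ - 2 * e) / (4 * (k + 1))) (i : ℕ) :
    apMax e k n₀ M < apMax e k n₀ i + (((apTime e k n₀ i + 2 * apSteps e i : ℕ) : ℝ) + 2) *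
      ((apMin e k n₀ (i + 1) - apMax e k n₀ i) / (k + 1)) / 2 := by
  have h0 := apMax_pos (k := k) he i
  have hg := half_le_apGap (e := e) (k := k) (n₀ := n₀) i
  have he' : 2 * (e : ℝ) < n₀ := by exact_mod_cast he
  have ht : (n₀ : ℝ) ≤ ((apTime e k n₀ i + 2 * apSteps e i : ℕ) : ℝ) := by
    exact_mod_cast (by simp only [apTime]; omega)
  have hk : 0 < (k : ℝ) + 1 := by positivity
  rw [apMin_succ, add_sub_cancel_left]
  refine hM.trans_le ?_
  have h1 : ((n₀ : ℝ) + 2) * (n₀ - 2 * e) / (4 * (k + 1))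
      = ((n₀ : ℝ) + 2) * ((n₀ / 2 - e) / (k + 1)) / 2 := by
    field_simp; ring
  rw [h1]
  have h2 : ((n₀ : ℝ) / 2 - e) / (k + 1) ≤ apGap e k n₀ i / (k + 1) :=
    div_le_div_of_nonneg_right hg hk.le
  have h3 : 0 ≤ ((n₀ : ℝ) / 2 - e) / (k + 1) := div_nonneg (by linarith) hk.le
  have h4 := mul_le_mul (add_le_add_left ht 2) h2 h3 (by positivity)
  linarith

/-! ### Induction along the chain -/

/-- The multiset `ξ` is split so that the `i`-th progression is about to reproduce. -/
def ReadySplit (e k n₀ M s : ℕ) (ξ : Multiset ℝ) (i : ℕ) (t : Multiset ℝ) : Prop :=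
  (∀ x ∈ t, apMax e k n₀ M < x) ∧ iterate ξ (apTime e k n₀ i + 1) ∈ t ∧
    IsSplit ξ (apTime e k n₀ i) (apMin e k n₀ i)
      (progression (apMin e k n₀ i + 1) 1 (apSteps e i) + (following e k n₀ M s i + t))

theorem ReadySplit.apMax_le {M s i : ℕ} {ξ t : Multiset ℝ} (he : 2 * e < n₀)
    (h : ReadySplit e k n₀ M s ξ i t) (hi : i ≤ M) {x : ℝ}
    (hx : x ∈ following e k n₀ M s i + t) : apMax e k n₀ i ≤ x := by
  rcases Multiset.mem_add.1 hx with hx | hx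
  · exact apMax_le_of_mem_following he hi hx
  · exact (apMax_mono he hi).trans (h.1 x hx).le

theorem ReadySplit.walk {M s i : ℕ} {ξ t : Multiset ℝ} (he : 2 * e < n₀)
    (h : ReadySplit e k n₀ M s ξ i t) (hi : i ≤ M) :
    IsSplit ξ (apTime e k n₀ i + 2 * apSteps e i) (apMax e k n₀ i)
      (progression (apMin e k n₀ (i + 1)) 1 (2 * apSteps e i) + (following e k n₀ M s i + t)) ∧
    ∀ j < 2 * apSteps e i,
      iterate ξ (apTime e k n₀ i + 2 + j) = apMin e k n₀ (i + 1) + j * 1 := by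
  obtain ⟨h1, h2, -⟩ := h.2.2.walk zero_le_one (apSteps e i) (fun x hx => h.apMax_le he hi hx)
    (apMin_succ' i) (apMax_lt_apMin_succ he i).le
  exact ⟨h1, h2⟩

theorem ReadySplit.reproduces {M s i : ℕ} {ξ t : Multiset ℝ} (he : 2 * e < n₀) (hn : 3 ≤ n₀)
    (h : ReadySplit e k n₀ M s ξ i t) (hi : i ≤ M) :
    Reproduces ξ (apTime e k n₀ i) (apList e k n₀ i) (apList e k n₀ (i + 1)) := by
  obtain ⟨h1, h2⟩ := h.walk he hi
  refine ⟨h.2.2.isReady one_pos (by simp only [apTime]; omega) (fun x hx => h.apMax_le he hi hx)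
    (Multiset.mem_add.2 (Or.inr h.2.1)), ?_, ?_⟩
  · intro u hu
    obtain ⟨j, hj, rfl⟩ := List.mem_map.1 hu
    have hj' : (j : ℝ) ≤ apSteps e i := by
      exact_mod_cast Nat.le_of_lt_succ (List.mem_range.1 hj)
    have hle : apMin e k n₀ i + j * 1 ≤ apMax e k n₀ i := by rw [apMax]; linarith
    constructor
    · exact hle.trans (h.apMax_le he hi (Multiset.mem_add.2 (Or.inr h.2.1)))
    · have := h2 0 (by simp [apSteps])
      rw [add_zero] at this
      rw [this]
      have := apMax_lt_apMin_succ (k := k) he i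
      simp only [Nat.cast_zero, zero_mul, add_zero]
      linarith
  · have hlen : 2 * ((apList e k n₀ i).length - 1) = apSteps e (i + 1) + 1 := by
      rw [apSteps_succ]; simp [apList]
    rw [hlen, apList]
    refine List.map_congr_left fun j hj => ?_
    rw [List.mem_range, apSteps_succ] at hj
    rw [h2 j hj]

/-- The median crosses A_i and then the gap. What the gap crossing emits lies beyond max A_M and
joins the remainder `t'`, so nothing new can fall inside the gap. -/
theorem ReadySplit.succ {M s i : ℕ} {ξ t : Multiset ℝ} (he : 2 * e < n₀)
    (hM : apMax e k n₀ M < ((n₀ : ℝ) + 2) * (n₀ - 2 * e) / (4 * (k + 1)))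
    (h : ReadySplit e k n₀ M s ξ i t) (hi : i < M) :
    (∃ t', ReadySplit e k n₀ M s ξ (i + 1) t') ∧
    between (stage ξ (apTime e k n₀ (i + 1))) (apMax e k n₀ i) (apMin e k n₀ (i + 1)) ≤
      obstacles e k n₀ i := by
  obtain ⟨h1, -⟩ := h.walk he hi.le
  have hlt := apMax_lt_apMin_succ (k := k) he i
  have hk : 0 < (k : ℝ) + 1 := by positivity
  have hgen := apMax_lt_generated he hM i
  have htop : apMin e k n₀ (i + 1) ≤ apMax e k n₀ M := by
    have := apMin_add_one_le_apMax (e := e) (k := k) (n₀ := n₀) (i + 1)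
    have := apMax_mono (k := k) he (Nat.succ_le_of_lt hi)
    simp only [Nat.succ_eq_add_one] at this
    linarith
  set a := apMax e k n₀ i with ha
  set b := apMin e k n₀ (i + 1) with hb
  set d := (b - a) / ((k : ℝ) + 1) with hd
  have hd0 : 0 ≤ d := div_nonneg (by linarith) hk.le
  set m := apTime e k n₀ i + 2 * apSteps e i with hm
  have hkd : a + ((k + 1 : ℕ) : ℝ) * d = b := by
    rw [hd]; push_cast; field_simp; ring
  have hbig : ∀ x ∈ following e k n₀ M s (i + 1) + t, b ≤ x := by
    intro x hx
    rcases Multiset.mem_add.1 hx with hx | hx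
    · have h2 := apMax_le_of_mem_following he (Nat.succ_le_of_lt hi) hx
      have := apMin_add_one_le_apMax (e := e) (k := k) (n₀ := n₀) (i + 1)
      simp only [Nat.succ_eq_add_one] at h2
      linarith
    · linarith [h.1 x hx]
  have hr : ∀ x ∈ progression (b + 1) 1 (apSteps e (i + 1)) +
      (following e k n₀ M s (i + 1) + t), b ≤ x := by
    intro x hx
    rcases Multiset.mem_add.1 hx with hx | hx
    · linarith [le_of_mem_progression zero_le_one hx]
    · exact hbig x hx
  -- The first element b of A_{i+1} is used as the endpoint of the gap, leaving `apSteps e (i + 1)`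
  -- elements of A_{i+1} after it.
  have hu : progression b 1 (2 * apSteps e i) + (following e k n₀ M s i + t) =
      progression (a + d) d (k + 1) + (progression (b + 1) 1 (apSteps e (i + 1)) +
        (following e k n₀ M s (i + 1) + t)) := by
    rw [hd, progression_eq_cons_equallySpaced, ← apSteps_succ, progression_succ,
      following_succ hi, obstacles]
    simp only [← Multiset.singleton_add]; abel
  obtain ⟨l, hl, -, hla⟩ := h1.exists_lower
  have h1' := h1
  rw [hu] at h1'
  obtain ⟨h2, h3, h4⟩ := h1'.walk hd0 (k + 1) (b := a + ((m : ℝ) + 2) * d / 2)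
    (by rw [hkd]; exact hr) rfl (by rw [hkd]; linarith)
  have hmt : m + 2 * (k + 1) = apTime e k n₀ (i + 1) := (apTime_succ i).symm
  set g := progression (a + ((m : ℝ) + 2) * d / 2) d (2 * (k + 1)) with hg
  have hgt : ∀ x ∈ g, apMax e k n₀ M < x := fun x hx =>
    hgen.trans_le (le_of_mem_progression hd0 hx)
  rw [hkd, hmt] at h2
  rw [hmt] at h4
  refine ⟨⟨g + t, ?_, ?_, ?_⟩, ?_⟩
  · intro x hx
    rcases Multiset.mem_add.1 hx with hx | hx
    · exact hgt x hx
    · exact h.1 x hx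
  · refine Multiset.mem_add.2 (Or.inl ?_)
    have := h3 (2 * k + 1) (by omega)
    rw [← hmt, show m + 2 * (k + 1) + 1 = m + 2 + (2 * k + 1) by ring, this]
    exact mem_progression.2 ⟨_, by omega, rfl⟩
  · convert h2 using 1
    abel
  -- The walk determines the multiset one time step later, which is larger; bounding its content in
  -- the gap suffices.
  · refine (between_mono (Multiset.le_cons_self _
      (iterate ξ (apTime e k n₀ (i + 1) + 1))) a b).trans ?_
    rw [← stage_succ h2.card_le, h4, hl, following_succ hi]
    have : g + (l + a ::ₘ (progression b 1 (2 * apSteps e i) +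
        (obstacles e k n₀ i + following e k n₀ M s (i + 1) + t))) =
        (g + (l + a ::ₘ (progression b 1 (2 * apSteps e i) +
        (following e k n₀ M s (i + 1) + t)))) + obstacles e k n₀ i := by
      simp only [← Multiset.singleton_add]; abel
    rw [this]
    refine between_add_le fun x hx => ?_
    rcases Multiset.mem_add.1 hx with hx | hx
    · exact Or.inr (htop.trans (hgt x hx).le)
    rcases Multiset.mem_add.1 hx with hx | hx
    · exact Or.inl (hla x hx)
    rcases Multiset.mem_cons.1 hx with rfl | hx
    · exact Or.inl le_rfl
    rcases Multiset.mem_add.1 hx with hx | hx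
    · exact Or.inr (le_of_mem_progression zero_le_one hx)
    · exact Or.inr (hbig x hx)

theorem ReadySplit.exists_of_zero {M s : ℕ} {ξ t : Multiset ℝ} (he : 2 * e < n₀)
    (hM : apMax e k n₀ M < ((n₀ : ℝ) + 2) * (n₀ - 2 * e) / (4 * (k + 1)))
    (h : ReadySplit e k n₀ M s ξ 0 t) : ∀ i ≤ M, ∃ t', ReadySplit e k n₀ M s ξ i t' := by
  intro i
  induction i with
  | zero => exact fun _ => ⟨t, h⟩
  | succ i ih =>
    intro hi
    obtain ⟨t', ht'⟩ := ih (by omega)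
    exact (ht'.succ he hM hi).1

theorem apList_headD (i : ℕ) : (apList e k n₀ i).headD 0 = apMin e k n₀ i := by
  simp [apList, List.range_succ_eq_map]

theorem apList_getLastD (i : ℕ) : (apList e k n₀ i).getLastD 0 = apMax e k n₀ i := by
  simp [apList, List.range_succ, apMax]

/-- After A_M no obstacles remain, and since s ≥ 1 the median at max A_M meets another copy of
itself. Both obstacle equalities come from the cycle: obstacles ≤ initial gap content ≤ later gap
content ≤ obstacles. -/
theorem ReadySplit.isReproductionChain {M s : ℕ} {ξ t : Multiset ℝ} (he : 2 * e < n₀)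
    (hn : 3 ≤ n₀) (hξ : Multiset.card ξ = n₀) (hM1 : 1 ≤ M) (hs : 1 ≤ s)
    (hM : apMax e k n₀ M < ((n₀ : ℝ) + 2) * (n₀ - 2 * e) / (4 * (k + 1)))
    (hobs : following e k n₀ M s 0 ≤ ξ) (h : ReadySplit e k n₀ M s ξ 0 t) :
    IsReproductionChain ξ k (M + 1) (apTime e k n₀) (apList e k n₀) ∧
    transitTime ξ = ((apTime e k n₀ M + 2 * apSteps e M + 2 : ℕ) : ℕ∞) := by
  have hall := h.exists_of_zero he hM
  have hbet : ∀ i < M, obstacles e k n₀ i ≤ between ξ (apMax e k n₀ i) (apMin e k n₀ (i + 1)) := by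
    intro i hi
    refine Multiset.le_filter.2 ⟨le_trans ?_ hobs,
      fun x hx => mem_equallySpaced (apMax_lt_apMin_succ he i) hx⟩
    rw [following]
    refine le_trans ?_ (Multiset.le_add_right _ _)
    exact Finset.single_le_sum (f := obstacles e k n₀) (fun _ _ => Multiset.zero_le _)
      (Finset.mem_Ico.2 ⟨Nat.zero_le _, hi⟩)
  have hbet' : ∀ i < M, between (stage ξ (apTime e k n₀ (i + 1))) (apMax e k n₀ i)
      (apMin e k n₀ (i + 1)) ≤ obstacles e k n₀ i := by
    intro i hi
    obtain ⟨t', ht'⟩ := hall i hi.le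
    exact (ht'.succ he hM hi).2
  have hstage : ∀ i, ξ ≤ stage ξ (apTime e k n₀ i) := fun i =>
    le_stage (by rw [hξ]; simp [apTime])
  obtain ⟨tM, htM⟩ := hall M le_rfl
  obtain ⟨hw, hwi⟩ := htM.walk he le_rfl
  obtain ⟨s, rfl⟩ := Nat.exists_eq_add_of_le hs
  have hu : progression (apMin e k n₀ (M + 1)) 1 (2 * apSteps e M) +
      (following e k n₀ M (1 + s) M + tM) = apMax e k n₀ M ::ₘ
      (progression (apMin e k n₀ (M + 1)) 1 (2 * apSteps e M) +
      (Multiset.replicate s (apMax e k n₀ M) + tM)) := by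
    simp only [following, Finset.Ico_self, Finset.sum_empty, Multiset.replicate_add,
      Multiset.replicate_one, ← Multiset.singleton_add]
    abel
  rw [hu] at hw
  refine ⟨?_, hw.transitTime_eq ?_⟩
  · refine
      { two_le := by omega
        start := by rw [apTime_zero, hξ]
        generated := fun i _ => by rw [apTime_succ]; simp [apList]; omega
        isAP := fun i _ => ⟨apMin e k n₀ i, 1, one_pos, by simp [apList]⟩
        reproduces := fun i hi => ?_
        gap_pos := fun i _ => ?_
        obstacles_initial := fun i hi => ?_
        obstacles := fun i hi => ?_
        stabilises := ⟨apTime e k n₀ M + 2 * apSteps e M + 2, fun m hm => ?_⟩ }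
    · obtain ⟨t', ht'⟩ := hall i (by omega)
      exact ht'.reproduces he hn (by omega)
    · rw [apList_headD, apList_getLastD]; exact apMax_lt_apMin_succ he i
    · rw [apList_headD, apList_getLastD]
      exact le_antisymm ((between_mono (hstage (i + 1)) _ _).trans (hbet' i (by omega)))
        (hbet i (by omega))
    · rw [apList_headD, apList_getLastD]
      exact le_antisymm (hbet' i (by omega))
        ((hbet i (by omega)).trans (between_mono (hstage (i + 1)) _ _))
    · obtain ⟨q, rfl⟩ := Nat.exists_eq_add_of_le hm
      rw [hw.stationary, Nat.add_sub_cancel, apList_getLastD]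
  -- The number preceding stabilisation is the last element of A_{M+1}, which exceeds max A_M.
  · have hpos : 1 ≤ apSteps e M := by simp [apSteps]
    have h1 := hwi (2 * apSteps e M - 1) (by omega)
    rw [show apTime e k n₀ M + 2 + (2 * apSteps e M - 1) =
      apTime e k n₀ M + 2 * apSteps e M + 1 by omega] at h1
    rw [h1]
    have h2 := apMax_lt_apMin_succ (k := k) he M
    have h3 : (0 : ℝ) ≤ ((2 * apSteps e M - 1 : ℕ) : ℝ) := Nat.cast_nonneg _
    intro h4
    linarith

/-! ### The initial multiset -/

theorem card_following (M s : ℕ) : Multiset.card (following e k n₀ M s 0) = k * M + s := by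
  simp [following, obstacles, equallySpaced, mul_comm]

/-- There is an initial multiset whose orbit consists of `M + 1` recursive reproductions. -/
theorem exists_isReproductionChain (e k m M : ℕ) (hM1 : 1 ≤ M) (hm : e + 1 + k * M < m)
    (hM : apMax e k (2 * m + 1) M <
      (((2 * m + 1 : ℕ) : ℝ) + 2) * ((2 * m + 1 : ℕ) - 2 * e) / (4 * (k + 1))) :
    ∃ ξ : Multiset ℝ, Multiset.card ξ = 2 * m + 1 ∧
      (∃ (N : ℕ) (n : ℕ → ℕ) (A : ℕ → List ℝ), (A 0).length = e + 2 ∧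
        IsReproductionChain ξ k N n A) ∧
      transitTime ξ =
        ((apTime e k (2 * m + 1) M + 2 * apSteps e M + 2 : ℕ) : ℕ∞) := by
  -- The s copies of max A_M pad the upper half to exactly m elements.
  obtain ⟨s, rfl⟩ : ∃ s, m = e + 1 + k * M + s := Nat.exists_eq_add_of_le hm.le
  have hs : 1 ≤ s := by omega
  set m := e + 1 + k * M + s with hmdef
  set n₀ := 2 * m + 1 with hn₀
  have he : 2 * e < n₀ := by omega
  have hB : 0 < apMax e k n₀ M := apMax_pos he M
  set B := apMax e k n₀ M with hBdef
  set u := progression (0 + 1) 1 (e + 1) + following e k n₀ M s 0 with hu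
  have hcardu : Multiset.card u = m := by
    rw [hu, Multiset.card_add, card_following, progression]
    simp only [Multiset.card_map, Multiset.card_range]; omega
  have hpos : ∀ x ∈ u, 0 ≤ x := by
    intro x hx
    rcases Multiset.mem_add.1 hx with hx | hx
    · linarith [le_of_mem_progression zero_le_one hx]
    · exact (apMax_pos (k := k) he 0).le.trans (apMax_le_of_mem_following he (Nat.zero_le M) hx)
  have hsum : 0 ≤ u.sum := Multiset.sum_nonneg hpos
  -- With m copies of -z below the median 0, the first new number is m z - sum u > B, out of the way
  -- of the chain.
  set z := u.sum + B + 1 with hz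
  set l := Multiset.replicate m (-z) with hl
  have hlow : ∀ x ∈ l, x ≤ 0 := by
    intro x hx
    rw [Multiset.eq_of_mem_replicate hx]; linarith
  set ξ := l + 0 ::ₘ u with hξ
  have hcard : Multiset.card ξ = n₀ := by
    simp only [hξ, hl, Multiset.card_add, Multiset.card_replicate, Multiset.card_cons, hcardu]
    omega
  have hmed : median ξ = 0 := median_odd hlow hpos (by simp [hl, hcardu])
  have hst : stage ξ n₀ = ξ := by rw [← hcard, stage_card]
  have hx : iterate ξ (n₀ + 1) = m * z - u.sum := by
    rw [iterate, Nat.add_sub_cancel, hst, newNumber, hmed, hξ]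
    simp [hl]
    ring
  have hxB : B < iterate ξ (n₀ + 1) := by
    have h1 : (1 : ℝ) ≤ m := by exact_mod_cast (by omega : 1 ≤ m)
    rw [hx]; nlinarith
  have hready : ReadySplit e k n₀ M s ξ 0 {iterate ξ (n₀ + 1)} := by
    refine ⟨by simpa using hxB, by rw [apTime_zero]; simp, ?_⟩
    rw [apTime_zero, apMin_zero]
    refine ⟨hcard.le, ⟨l, ?_, by simp [hl, hn₀], hlow⟩, ?_, ?_⟩
    · rw [stage_succ hcard.le, hst, hξ, hu, apSteps, pow_zero, mul_one]
      simp only [← Multiset.singleton_add]; abel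
    · intro x hx
      rw [apSteps, pow_zero, mul_one, ← add_assoc] at hx
      rcases Multiset.mem_add.1 hx with hx | hx
      · exact hpos x hx
      · rw [Multiset.mem_singleton.1 hx]; linarith
    · rw [sum_stage_succ hcard.le, hst, hmed]
  have hobs : following e k n₀ M s 0 ≤ ξ := by
    rw [hξ, hu]
    exact ((Multiset.le_add_left _ _).trans (Multiset.le_cons_self _ _)).trans
      (Multiset.le_add_left _ _)
  obtain ⟨h1, h2⟩ := hready.isReproductionChain he (by omega) hcard hM1 hs hM hobs
  exact ⟨ξ, hcard, ⟨M + 1, apTime e k n₀, apList e k n₀, by simp [apList, apSteps], h1⟩, h2⟩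

end Chain

end MMM

/-! ### Choice of parameters and asymptotics -/

namespace MMM

/-- For M ≈ μn the leading-order constraint is (k+2)μ²/2 + μ/2 ≤ 1/(4(k+1)). The chosen μ is the
positive root of equality (`hμ2`), and the time n + 2(k+2)M has leading coefficient 1 + 2(k+2)μ = c.
-/
theorem exists_pairs (k m : ℕ) (hm : 10 * (k + 2) ≤ m) {c μ : ℝ}
    (hc : c = Real.sqrt ((3 * (k : ℝ) + 5) / ((k : ℝ) + 1)))
    (hμ : μ = (c - 1) / (2 * (k + 2))) :
    ∃ ξ : Multiset ℝ, Multiset.card ξ = 2 * m + 1 ∧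
      (∃ (N : ℕ) (n : ℕ → ℕ) (A : ℕ → List ℝ), (A 0).length = 2 ∧
        IsReproductionChain ξ k N n A) ∧
      ∃ t : ℕ, transitTime ξ = (t : ℕ∞) ∧
        (t : ℝ) = (2 * m + 1 : ℕ) + 2 * (k + 2) * (⌊μ * (2 * m + 1 : ℕ)⌋₊ - 2) + 4 := by
  have hk : (0 : ℝ) ≤ k := Nat.cast_nonneg k
  have hc2 : c ^ 2 * (k + 1) = 3 * k + 5 := by
    rw [hc, Real.sq_sqrt (by positivity)]; field_simp
  have hc0 : 0 ≤ c := hc ▸ Real.sqrt_nonneg _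
  have hc_lower : 3 / 2 ≤ c := by
    by_contra h
    have : c ^ 2 < 9 / 4 := by nlinarith
    nlinarith
  have hc_upper : c ≤ 3 := by
    by_contra h
    have : 9 < c ^ 2 := by nlinarith
    nlinarith
  have hμc : 2 * ((k : ℝ) + 2) * μ = c - 1 := by rw [hμ]; field_simp
  have hμ0 : 0 < μ := by rw [hμ]; apply div_pos <;> linarith
  have hμ1 : μ ≤ 1 / 2 := by nlinarith
  have hμ2 : 1 / (4 * ((k : ℝ) + 1)) = (k + 2) * μ ^ 2 / 2 + μ / 2 := by
    have hcc : c = 2 * ((k : ℝ) + 2) * μ + 1 := by linarith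
    rw [hcc] at hc2
    rw [div_eq_iff (by positivity)]
    refine mul_left_cancel₀ (show ((k : ℝ) + 2) ≠ 0 by positivity) ?_
    linarith
  set n := 2 * m + 1 with hn
  have hnr : (n : ℝ) = 2 * m + 1 := by rw [hn]; push_cast; ring
  have hmr : 10 * ((k : ℝ) + 2) ≤ m := by exact_mod_cast hm
  have hx1 : (⌊μ * n⌋₊ : ℝ) ≤ μ * n := Nat.floor_le (by positivity)
  have hx2 : 5 ≤ ⌊μ * n⌋₊ := by
    refine Nat.le_floor ?_
    have : (20 * ((k : ℝ) + 2)) * μ ≤ n * μ := by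
      apply mul_le_mul_of_nonneg_right _ hμ0.le; linarith
    push_cast
    linarith
  set x := ⌊μ * n⌋₊
  -- Stopping two short of ⌊μn⌋ frees a term n, which absorbs the M + 1 in `apMax`.
  obtain ⟨M, hM⟩ : ∃ M, x = M + 2 := ⟨x - 2, by omega⟩
  have hMr : (x : ℝ) - 2 = M := by rw [hM]; push_cast; ring
  have hMn : (M : ℝ) ≤ μ * n - 2 := by linarith
  have hM0 : (0 : ℝ) ≤ M := Nat.cast_nonneg M
  have hn0 : (0 : ℝ) ≤ n := Nat.cast_nonneg n
  -- The kM obstacles must fit in the upper half; for k ≥ 1 this holds because c ≤ 2 gives (k+2)μ ≤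
  -- 1/2.
  have hroom : 0 + 1 + k * M < m := by
    rcases Nat.eq_zero_or_pos k with rfl | hk1
    · omega
    · have hk1' : (1 : ℝ) ≤ k := by exact_mod_cast hk1
      have hc3 : c ≤ 2 := by
        by_contra h
        have : 4 < c ^ 2 := by nlinarith
        nlinarith
      have h1 : (k : ℝ) * M ≤ k * (μ * n - 2) := mul_le_mul_of_nonneg_left hMn hk
      have h2 : ((k : ℝ) + 2) * μ * n ≤ 1 / 2 * n :=
        mul_le_mul_of_nonneg_right (by linarith) hn0
      have h3 : (20 * ((k : ℝ) + 2)) * μ ≤ n * μ := by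
        apply mul_le_mul_of_nonneg_right _ hμ0.le; linarith
      have : (0 : ℝ) + 1 + k * M < m := by linarith
      exact_mod_cast this
  have hcond : apMax 0 k n M < ((n : ℝ) + 2) * (n - 2 * (0 : ℕ)) / (4 * (k + 1)) := by
    have h1 : ((n : ℝ) + 2) * (n - 2 * (0 : ℕ)) / (4 * (k + 1))
        = (n + 2) * n * ((k + 2) * μ ^ 2 / 2 + μ / 2) := by
      rw [← hμ2]; push_cast; ring
    have h2 : apMax 0 k n M = M + 1 + M * n / 2 + (k + 2) * (M * (M - 1)) / 2 := by
      simp only [apMax, apMin, apSteps]; push_cast; ring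
    have h3 : (M : ℝ) * n ≤ (μ * n - 2) * n := mul_le_mul_of_nonneg_right hMn hn0
    have h4 : (M : ℝ) * (M - 1) ≤ (μ * n) ^ 2 := by nlinarith
    have h5 : ((k : ℝ) + 2) * (M * (M - 1)) ≤ (k + 2) * (μ * n) ^ 2 :=
      mul_le_mul_of_nonneg_left h4 (by positivity)
    have h6 : μ * n ≤ 1 / 2 * n := mul_le_mul_of_nonneg_right hμ1 hn0
    have h7 : 0 ≤ (k + 2) * μ ^ 2 * n := by positivity
    have h8 : 0 ≤ μ * n := by positivity
    rw [h1, h2]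
    linarith
  obtain ⟨ξ, h1, h2, h3⟩ := exists_isReproductionChain 0 k m M (by omega) hroom hcond
  refine ⟨ξ, h1, h2, _, h3, ?_⟩
  push_cast [cast_apTime, apSteps]
  rw [hMr]
  simp [hn]; ring

/-- With M = 2s - 1 and m = 2^s + 4s, max A_M is 4^s plus about 2s·2^s, while the bound is about m²
= 4^s + 8s·2^s + 16s²; the summand 4s in m provides the room. -/
theorem exists_progressions (s : ℕ) (hs : 1 ≤ s) :
    ∃ ξ : Multiset ℝ, Multiset.card ξ = 2 * (2 ^ s + 4 * s) + 1 ∧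
      (∃ (N : ℕ) (n : ℕ → ℕ) (A : ℕ → List ℝ), (A 0).length = 3 ∧
        IsReproductionChain ξ 0 N n A) ∧
      ∃ t : ℕ, transitTime ξ = (t : ℕ∞) ∧
        (t : ℝ) = 2 * (2 ^ s) ^ 2 + 2 * 2 ^ s + 16 * s - 1 := by
  obtain ⟨j, rfl⟩ := Nat.exists_eq_add_of_le' hs
  have hp : (2 : ℝ) ^ (2 * j + 1) = (2 ^ (j + 1)) ^ 2 / 2 := by ring
  have hp0 : (0 : ℝ) < 2 ^ (j + 1) := by positivity
  have hj : (0 : ℝ) ≤ j := Nat.cast_nonneg j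
  obtain ⟨ξ, h1, h2, h3⟩ := exists_isReproductionChain 1 0 (2 ^ (j + 1) + 4 * (j + 1)) (2 * j + 1)
    (by omega) (by have := Nat.one_le_two_pow (n := j + 1); omega) (by
      simp only [apMax, apMin, apSteps]
      push_cast
      rw [hp]
      generalize (2 : ℝ) ^ (j + 1) = p at *
      have : 0 ≤ (j : ℝ) * p := by positivity
      nlinarith)
  refine ⟨ξ, h1, h2, _, h3, ?_⟩
  push_cast [cast_apTime, apSteps]
  rw [hp]
  ring

theorem tendsto_floor_ratio (k : ℕ) {c μ : ℝ} (hμ : 0 ≤ μ) (hc : 2 * ((k : ℝ) + 2) * μ = c - 1)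
    (b : ℕ) :
    Tendsto (fun j : ℕ => (((2 * (j + b) + 1 : ℕ) : ℝ) +
      2 * (k + 2) * (⌊μ * (2 * (j + b) + 1 : ℕ)⌋₊ - 2) + 4) / ((2 * (j + b) + 1 : ℕ) : ℝ))
      atTop (nhds c) := by
  have hn : Tendsto (fun j : ℕ => ((2 * (j + b) + 1 : ℕ) : ℝ)) atTop atTop :=
    tendsto_natCast_atTop_atTop.comp (tendsto_atTop_mono (fun j => by rw [id]; omega) tendsto_id)
  have h1 := (tendsto_nat_floor_mul_div_atTop hμ).comp hn
  have h2 := tendsto_inv_atTop_zero.comp hn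
  have h3 := ((h1.const_mul (2 * ((k : ℝ) + 2))).const_add 1).add
    (h2.const_mul (4 - 4 * ((k : ℝ) + 2)))
  rw [mul_zero, add_zero, hc, add_sub_cancel] at h3
  refine h3.congr fun j => ?_
  have hpos : ((2 * (j + b) + 1 : ℕ) : ℝ) ≠ 0 := by positivity
  simp only [Function.comp_apply]
  generalize ((2 * (j + b) + 1 : ℕ) : ℝ) = y at *
  field_simp
  ring

theorem tendsto_quadratic_ratio :
    Tendsto (fun s : ℕ => (2 * ((2 : ℝ) ^ s) ^ 2 + 2 * 2 ^ s + 16 * s - 1) /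
      (((2 * (2 ^ s + 4 * s) + 1 : ℕ) : ℝ) ^ 2 / 2)) atTop (nhds 1) := by
  have h1 := tendsto_pow_const_div_const_pow_of_one_lt 1 (r := (2 : ℝ)) one_lt_two
  have h2 := tendsto_pow_const_div_const_pow_of_one_lt 0 (r := (2 : ℝ)) one_lt_two
  simp only [pow_one, pow_zero] at h1 h2
  -- Numerator and denominator are both divided by 4^s.
  have hnum := ((h2.const_mul 2).const_add 2).add ((h1.mul h2).const_mul 16) |>.sub (h2.mul h2)
  have hden := ((((h1.const_mul 4).const_add 1).add (h2.const_mul (1 / 2))).pow 2).const_mul 2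
  have h := hnum.div hden (by norm_num)
  rw [show ((2 : ℝ) + 2 * 0 + 16 * (0 * 0) - 0 * 0) / (2 * (1 + 4 * 0 + 1 / 2 * 0) ^ 2) = 1 by
    norm_num] at h
  refine h.congr fun s => ?_
  have hp : (2 : ℝ) ^ s ≠ 0 := by positivity
  have hq : (2 * ((2 : ℝ) ^ s + 4 * s) + 1) ≠ 0 := by positivity
  rw [Pi.div_apply]
  push_cast
  generalize (2 : ℝ) ^ s = p at *
  field_simp

end MMM

theorem mainTheorem1 :
    (∀ k : ℕ, ∃ (ξ : ℕ → Multiset ℝ) (t : ℕ → ℕ),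
      StrictMono (fun j => Multiset.card (ξ j)) ∧
      (∀ j, ∃ (N : ℕ) (n : ℕ → ℕ) (A : ℕ → List ℝ),
        (A 0).length = 2 ∧ MMM.IsReproductionChain (ξ j) k N n A) ∧
      (∀ j, MMM.transitTime (ξ j) = (t j : ℕ∞)) ∧
      (fun j => (t j : ℝ)) ~[atTop]
        (fun j => Real.sqrt ((3 * (k : ℝ) + 5) / ((k : ℝ) + 1)) * (Multiset.card (ξ j) : ℝ))) ∧
    (∃ (ξ : ℕ → Multiset ℝ) (t : ℕ → ℕ),
      StrictMono (fun j => Multiset.card (ξ j)) ∧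
      (∀ j, ∃ (N : ℕ) (n : ℕ → ℕ) (A : ℕ → List ℝ),
        (A 0).length = 3 ∧ MMM.IsReproductionChain (ξ j) 0 N n A) ∧
      (∀ j, MMM.transitTime (ξ j) = (t j : ℕ∞)) ∧
      (fun j => (t j : ℝ)) ~[atTop] (fun j => (Multiset.card (ξ j) : ℝ) ^ 2 / 2)) := by
  constructor
  · intro k
    obtain ⟨c, hc⟩ : ∃ c, c = Real.sqrt ((3 * (k : ℝ) + 5) / ((k : ℝ) + 1)) := ⟨_, rfl⟩
    obtain ⟨μ, hμ⟩ : ∃ μ, μ = (c - 1) / (2 * ((k : ℝ) + 2)) := ⟨_, rfl⟩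
    have hc1 : 1 ≤ c := by
      rw [hc, Real.one_le_sqrt, one_le_div (by positivity)]
      linarith [Nat.cast_nonneg (α := ℝ) k]
    choose ξ hcard hchain t ht htr using fun j : ℕ =>
      MMM.exists_pairs k (j + 10 * (k + 2)) (by omega) hc hμ
    refine ⟨ξ, t, strictMono_nat_of_lt_succ fun j => ?_, hchain, ht, ?_⟩
    · simp only [hcard]; omega
    · refine isEquivalent_of_tendsto_one ?_
      have h := (MMM.tendsto_floor_ratio k (div_nonneg (by linarith) (by positivity))
        (show 2 * ((k : ℝ) + 2) * ((c - 1) / (2 * ((k : ℝ) + 2))) = c - 1 by field_simp)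
        (10 * (k + 2))).div_const c
      rw [div_self (by linarith)] at h
      refine h.congr fun j => ?_
      rw [← hc, ← hμ, Pi.div_apply, htr, hcard, div_div, mul_comm c]
  · choose ξ hcard hchain t ht htr using fun j : ℕ =>
      MMM.exists_progressions (j + 1) (Nat.succ_le_succ (Nat.zero_le j))
    refine ⟨ξ, t, strictMono_nat_of_lt_succ fun j => ?_, hchain, ht, ?_⟩
    · have : 2 ^ (j + 1) < 2 ^ (j + 1 + 1) := Nat.pow_lt_pow_right one_lt_two (by omega)
      simp only [hcard]; omega
    · refine isEquivalent_of_tendsto_one ?_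
      refine (MMM.tendsto_quadratic_ratio.comp (tendsto_add_atTop_nat 1)).congr fun j => ?_
      rw [Pi.div_apply, htr, hcard, Function.comp_apply]
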